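/- Let $L\ge 2$, $w\neq 0$, $q>0$ with $q\neq 1$, and $z>0$ be real. Consider configurations $\eta=(\eta(1),\dots,\eta(L))\in\{0,1\}^L$ on the ring of $L$ sites (site $L+1$ is site $1$), with particle number $N(\eta)=\sum_k\eta(k)$, and let $\Omega_N$ be the set of configurations with $N$ particles. A configuration is identified with the set $\vec x=\{x_1,\dots,x_K\}$ of its occupied sites. For $\alpha,\beta>0$ let $H(q,\alpha,\beta)$ be the weighted generator of the conditioned ASEP with periodic boundary conditions, i.e. the matrix on $\mathbb{R}^{\{0,1\}^L}$ with $$H(q,\alpha,\beta)\,|\eta\rangle=\sum_{k=1}^{L}\Big(w\big[q\,\eta(k)(1-\eta(k+1))+q^{-1}(1-\eta(k))\eta(k+1)\big]|\eta\rangle-w\big[\alpha_k\,\eta(k)(1-\eta(k+1))+\alpha_k^{-1}(1-\eta(k))\eta(k+1)\big]|\eta^{k,k+1}\rangle\Big),$$ where $\eta^{k,k+1}$ is $\eta$ with the occupation numbers of sites $k$ and $k+1$ exchanged, $\alpha_k=\alpha$ for $k<L$ and $\alpha_L=\alpha\beta$. (With $\alpha=qe^{s}$ and $\beta=e^{\bar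 s}$, every jump to the right/left gets the weight $e^{\pm s}$, and every such jump across the bond $(L,1)$ an extra weight $e^{\pm\bar s}$.) Let $\mathbf 1_N$ be the projector on $\Omega_N$ and let $$H_N^K:=\mathbf 1_N\,H\big(q,q^{1-2K/L},1\big)\,\mathbf 1_N$$ be the generator of the $N$-particle ASEP globally conditioned with driving strength $s=-\frac{2K}{L}\ln q$. For $\vec x\in\Omega_K$ let $|\mu_{\vec x}\rangle$ be the unnormalized shock/antishock measure $$\mu_{\vec x}(\eta)=z^{N(\eta)}\prod_{j=1}^{K}\Big[z^{-1}q^{\frac2L\sum_{l=1}^{L}(x_j-l)\eta(l)-\sum_{i=1}^{x_j-1}\eta(i)+\sum_{i=x_j+1}^{L}\eta(i)}\,\eta(x_j)\Big],$$ and let $|\mu^N_{\vec x}\rangle=\mathbf 1_N|\mu_{\vec x}\rangle$ be its restriction to $N$ particles. Then for all $N$ and $K$, all $\vec x\in\Omega_K$ and all times $t$, $$e^{-H_N^K t}\,|\mu^N_{\vec x}\rangle=\sum_{\vec y\in\Omega_K}P^N(\vec y,t\,|\,\vec x,0)\,|\mu^N_{\vec y}\rangle,\qquad P^N(\vec y,t\,|\,\vec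 x,0):=\langle\vec y|\,e^{-H_K^N t}\,|\vec x\rangle,$$ where $H_K^N=\mathbf 1_K\,H(q,q^{1-2N/L},1)\,\mathbf 1_K$, so that the weights are the conditioned $K$-particle transition probabilities from $\vec x$ to $\vec y$ at time $t$ with driving strength $s'=-\frac{2N}{L}\ln q$. -/

import Mathlib

open scoped Matrix

noncomputable section

namespace ASEP

/-- Configurations `η ∈ {0,1}^L` on the ring of `L` sites. The index `k : Fin L` is the site with
label `k + 1 ∈ {1, …, L}`; clockwise order is increasing order of the label. -/
abbrev Config (L : ℕ) : Type := Fin L → Fin 2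

/-- The occupation number `η(k) ∈ {0,1}` as a real number. -/
def occ {L : ℕ} (η : Config L) (k : Fin L) : ℝ := ((η k : ℕ) : ℝ)

/-- The label `k + 1 ∈ {1, …, L}` of a site, as a real number. -/
def site {L : ℕ} (k : Fin L) : ℝ := ((k : ℕ) : ℝ) + 1

/-- The particle number `N(η) = ∑ₖ η(k)`. -/
def particleNumber {L : ℕ} (η : Config L) : ℕ := ∑ k, (η k : ℕ)

/-- The clockwise neighbour of a site on the ring: `k ↦ k + 1` for `k < L`, and `L ↦ 1`. -/
def next {L : ℕ} (k : Fin L) : Fin L := finRotate L k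

/-- The configuration obtained from `η` by exchanging the occupation numbers of the sites
`k` and `k + 1` (`L` and `1` when `k = L`). -/
def exchange {L : ℕ} (k : Fin L) (η : Config L) : Config L := η ∘ Equiv.swap k (next k)

/-- The weighted rate `w [a η(k) (1 - η(k+1)) + a⁻¹ (1 - η(k)) η(k+1)]` of the jumps across the bond
`(k, k+1)`. With `a = q` these are the rates of the ASEP; with `a = q eˢ` each jump to the right
(left) gets the additional weight `eˢ` (`e⁻ˢ`). -/
def bondRate {L : ℕ} (w a : ℝ) (k : Fin L) (η : Config L) : ℝ :=
  w * (a * occ η k * (1 - occ η (next k)) + a⁻¹ * (1 - occ η k) * occ η (next k))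

/-- The jump parameter of the bond `(k, k+1)`: it is `α` in the bulk and `α β` on the bond `(L, 1)`. -/
def bondParam {L : ℕ} (α β : ℝ) (k : Fin L) : ℝ := if (k : ℕ) + 1 = L then α * β else α

/-- The weighted generator `H(q, α, β)` of the conditioned ASEP with periodic boundary conditions,
as a matrix acting on column vectors indexed by configurations, with the sign convention
`d/dt |P⟩ = - H |P⟩`. The off-diagonal part is minus the weighted rates with `α = q eˢ`, `β = e^{s̄}`;
the diagonal part is the total escape rate of the unconditioned ASEP. -/
def weightedGenerator (L : ℕ) (w q α β : ℝ) : Matrix (Config L) (Config L) ℝ :=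
  Matrix.of fun η' η => ∑ k : Fin L,
    ((if η' = η then bondRate w q k η else 0)
      - (if η' = exchange k η then bondRate w (bondParam α β k) k η else 0))

/-- The projector on configurations with `N` particles. -/
def projector (L N : ℕ) : Matrix (Config L) (Config L) ℝ :=
  Matrix.diagonal fun η => if particleNumber η = N then 1 else 0

/-- The generator `H_N^K = 1_N H(q, q^{1 - 2K/L}, 1) 1_N` of the globally conditioned ASEP with `N`
particles. -/
def globalGenerator (L : ℕ) (w q : ℝ) (N K : ℕ) : Matrix (Config L) (Config L) ℝ :=
  projector L N * weightedGenerator L w q (q ^ (1 - 2 * (K : ℝ) / (L : ℝ))) 1 * projector L N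

/-- The parameter `α = q^{1 - 2K/L}` is `q eˢ` with driving strength `s = -(2K/L) ln q`. -/
theorem globalGenerator_drivingStrength {q : ℝ} (hq : 0 < q) (L K : ℕ) :
    q * Real.exp (-(2 * (K : ℝ) / (L : ℝ)) * Real.log q) = q ^ (1 - 2 * (K : ℝ) / (L : ℝ)) := by
  rw [sub_eq_add_neg, Real.rpow_add hq, Real.rpow_one, Real.rpow_def_of_pos hq (-_), mul_comm
    (Real.log q)]

/-- The shock/antishock measure `μ_x` (unnormalized), as the vector of its weights: for every
configuration `η` and every configuration `x` of shock positions,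
`μ_x(η) = z^{N(η)} ∏_j [z⁻¹ q^{(2/L) ∑_l (x_j - l) η(l) - ∑_{i < x_j} η(i) + ∑_{i > x_j} η(i)} η(x_j)]`,
the product being over the positions `x_j` of the particles of `x`. -/
def shockMeasure (L : ℕ) (q z : ℝ) (x : Config L) : Config L → ℝ := fun η =>
  (∏ j : Fin L with x j = 1,
    (z⁻¹ * q ^ (2 / (L : ℝ) * ∑ l : Fin L, (site j - site l) * occ η l
          - ∑ i : Fin L with i < j, occ η i + ∑ i : Fin L with j < i, occ η i)
      * occ η j))
  * z ^ particleNumber η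

/-- The restriction `|μ_x^N⟩ = 1_N |μ_x⟩` of the shock/antishock measure to `N` particles. -/
def shockMeasureN (L : ℕ) (q z : ℝ) (N : ℕ) (x : Config L) : Config L → ℝ :=
  projector L N *ᵥ shockMeasure L q z x

/-- The conditioned `K`-particle transition probability
`P^N(y, t | x, 0) = ⟨y| exp(- H_K^N t) |x⟩`. -/
def transitionProb (L : ℕ) (w q : ℝ) (K N : ℕ) (t : ℝ) (y x : Config L) : ℝ :=
  NormedSpace.exp (-(t • globalGenerator L w q K N)) y x

end ASEP

end

/-! On the sector with `N` and `K` particles, `μ_x(η)` is the constant `z ^ N * z⁻¹ ^ K` times `D(η,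
x) = q ^ interaction η x * inclusion η x`, where `interaction` is an antisymmetric pair sum. The
claim is that `D` is a duality function: the `N`-particle generator acting on `η` equals the
`K`-particle generator acting on `x`. A jump across a bond changes the exponent by `± (2N/L - η(k) -
η(k+1))` or its mirror image with `K` and `x`. The conditioned rates cancel exactly the nonlocal
parts `2N/L` and `2K/L`, leaving a check on four occupation numbers (`bond_duality`). It fails only
by a discrete gradient, which sums to zero around the ring (`sum_bond_duality`). So the matrix with
columns `μ_x^N` intertwines the generators, hence their exponentials; column `x` of that identity is
the theorem. -/

noncomputable section

namespace ASEP

/-! ### Exchanges and occupation numbers on the ring -/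

section Ring

variable {L : ℕ}

theorem next_ne (hL : 2 ≤ L) (k : Fin L) : next k ≠ k := by
  obtain ⟨n, rfl⟩ : ∃ n, L = n + 1 := ⟨L - 1, by omega⟩
  intro h
  have h' := congrArg Fin.val h
  rw [next, coe_finRotate] at h'
  split_ifs at h' with hk
  · have := congrArg Fin.val hk
    simp only [Fin.val_last] at this
    omega
  · omega

theorem exchange_exchange (k : Fin L) (η : Config L) : exchange k (exchange k η) = η := by
  funext l
  simp [exchange]

theorem eq_exchange_comm {k : Fin L} {η ζ : Config L} : ζ = exchange k η ↔ η = exchange k ζ :=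
  ⟨fun h => by rw [h, exchange_exchange], fun h => by rw [h, exchange_exchange]⟩

@[simp]
theorem particleNumber_exchange (k : Fin L) (η : Config L) :
    particleNumber (exchange k η) = particleNumber η :=
  Equiv.sum_comp (Equiv.swap k (next k)) fun l => (η l : ℕ)

theorem sum_occ (η : Config L) : ∑ k, occ η k = particleNumber η := by
  simp [occ, particleNumber]

/-- The additive form lets sums linear in the occupation numbers be updated without splitting into
cases. -/
theorem occ_exchange (k l : Fin L) (η : Config L) :
    occ (exchange k η) l = occ η l
      + (occ η k - occ η (next k)) * ((if l = next k then 1 else 0) - (if l = k then 1 else 0)) := by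
  by_cases h1 : l = k
  · subst h1
    by_cases h2 : l = next l
    · simp [occ, exchange, ← h2]
    · simp [occ, exchange, h2]
  · by_cases h2 : l = next k
    · subst h2
      simp [occ, exchange, h1]
    · simp [occ, exchange, h1, h2, Equiv.swap_apply_of_ne_of_ne]

theorem occ_exchange_left (k : Fin L) (η : Config L) :
    occ (exchange k η) k = occ η (next k) := by
  simp [occ, exchange]

theorem occ_exchange_right (k : Fin L) (η : Config L) :
    occ (exchange k η) (next k) = occ η k := by
  simp [occ, exchange]

theorem apply_eq_zero_or_one (η : Config L) (k : Fin L) : η k = 0 ∨ η k = 1 := by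
  omega

theorem occ_eq_zero_or_one (η : Config L) (k : Fin L) : occ η k = 0 ∨ occ η k = 1 := by
  unfold occ
  rcases apply_eq_zero_or_one η k with h | h <;> simp [h]

theorem sum_occ_sub_occ_next (η : Config L) : ∑ k, (occ η k - occ η (next k)) = 0 := by
  rw [Finset.sum_sub_distrib, sub_eq_zero]
  exact (Equiv.sum_comp (finRotate L) (occ η)).symm

end Ring

/-! ### The periodic pair potential -/

section Sawtooth

variable {L : ℕ}

/-- The sawtooth function `(2/L) (j - l) - sgn (j - l)`, which is periodic on the ring. -/
def sawtooth (j l : Fin L) : ℝ :=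
  2 / (L : ℝ) * (site j - site l) - (if l < j then 1 else 0) + (if j < l then 1 else 0)

theorem sawtooth_antisymm (j l : Fin L) : sawtooth l j = -sawtooth j l := by
  unfold sawtooth
  ring

/-- The slope is `2 / L`, and the drop by 2 at `j = l` is split into two halves since the sign is 0
there. Across the bond `(L, 1)` the linear part loses an extra 2, which the sign change restores. -/
theorem sawtooth_next_left (hL : 2 ≤ L) (k l : Fin L) :
    sawtooth (next k) l - sawtooth k l
      = 2 / (L : ℝ) - (if l = k then 1 else 0) - (if l = next k then 1 else 0) := by
  obtain ⟨n, rfl⟩ : ∃ n, L = n + 1 := ⟨L - 1, by omega⟩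
  have hn : ((n + 1 : ℕ) : ℝ) ≠ 0 := by positivity
  have hval : (next k : ℕ) = if k = Fin.last n then 0 else (k : ℕ) + 1 := coe_finRotate k
  have hl := l.isLt
  have hk := k.isLt
  simp only [sawtooth, site, Fin.lt_def, Fin.ext_iff, hval, Fin.val_last]
  by_cases h : (k : ℕ) = n
  · have hkn : ((k : ℕ) : ℝ) = n := by rw [h]
    rw [if_pos h, hkn, h]
    rcases eq_or_ne (l : ℕ) n with h1 | h1
    · have : 0 < (l : ℕ) := by omega
      simp [h1, show n ≠ 0 by omega, show 0 < n by omega]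
      push_cast at hn
      field_simp
      ring
    · rcases Nat.eq_zero_or_pos (l : ℕ) with h2 | h2
      · simp [h2, show 0 < n by omega, show 0 ≠ n by omega]
        push_cast at hn
        field_simp
        ring
      · simp [h1, h2, show (l : ℕ) < n by omega, show ¬ n < (l : ℕ) by omega,
          show (l : ℕ) ≠ 0 by omega]
        push_cast at hn
        field_simp
        ring
  · rw [if_neg h]
    rcases lt_trichotomy (l : ℕ) k with h1 | h1 | h1
    · simp [h1, show (l : ℕ) < k + 1 by omega, show ¬ (k : ℕ) + 1 < l by omega,
          show ¬ (k : ℕ) < l by omega, show (l : ℕ) ≠ k by omega, show (l : ℕ) ≠ k + 1 by omega]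
      ring
    · simp [h1]
    · rcases eq_or_ne (l : ℕ) (k + 1) with h2 | h2
      · simp [h2]
        ring
      · simp [h1, h2, show ¬ (l : ℕ) < k + 1 by omega, show (k : ℕ) + 1 < l by omega,
          show ¬ (l : ℕ) < k by omega, show (l : ℕ) ≠ k by omega]
        ring

end Sawtooth

/-! ### Bondwise duality -/

section Duality

variable {L : ℕ}

/-- The exponent of `q` in the weight `μ_x(η)`: the sum of the sawtooth function over the pairs of a
particle of `x` and a particle of `η`. -/
def interaction (η x : Config L) : ℝ := ∑ j, ∑ l, occ x j * occ η l * sawtooth j l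

theorem interaction_swap (η x : Config L) : interaction x η = -interaction η x := by
  unfold interaction
  rw [Finset.sum_comm, ← Finset.sum_neg_distrib]
  refine Finset.sum_congr rfl fun j _ => ?_
  rw [← Finset.sum_neg_distrib]
  refine Finset.sum_congr rfl fun l _ => ?_
  rw [sawtooth_antisymm]
  ring

theorem interaction_exchange_right (hL : 2 ≤ L) (k : Fin L) (η x : Config L) :
    interaction η (exchange k x) = interaction η x
      + (occ x k - occ x (next k))
        * (2 * (particleNumber η : ℝ) / L - occ η k - occ η (next k)) := by
  have h : ∑ l, occ η l * (sawtooth (next k) l - sawtooth k l)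
      = 2 * (particleNumber η : ℝ) / L - occ η k - occ η (next k) := by
    simp only [sawtooth_next_left hL, mul_sub, mul_ite, mul_one, mul_zero,
      Finset.sum_sub_distrib, ← Finset.sum_mul, sum_occ]
    simp
    ring
  rw [← h]
  unfold interaction
  have hj : ∀ j, ∑ l, occ (exchange k x) j * occ η l * sawtooth j l
      = ∑ l, occ x j * occ η l * sawtooth j l
        + (occ x k - occ x (next k)) * ((if j = next k then ∑ l, occ η l * sawtooth j l else 0)
          - (if j = k then ∑ l, occ η l * sawtooth j l else 0)) := by
    intro j
    simp only [mul_assoc, ← Finset.mul_sum, occ_exchange]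
    split_ifs <;> ring
  simp only [hj, Finset.sum_add_distrib, ← Finset.mul_sum, Finset.sum_sub_distrib, mul_sub]
  simp

theorem interaction_exchange_left (hL : 2 ≤ L) (k : Fin L) (η x : Config L) :
    interaction (exchange k η) x = interaction η x
      - (occ η k - occ η (next k))
        * (2 * (particleNumber x : ℝ) / L - occ x k - occ x (next k)) := by
  have h := interaction_exchange_right hL k x η
  rw [interaction_swap (exchange k η) x, interaction_swap η x] at h
  linarith

/-- The indicator, with value in `ℝ`, that all particles of `x` sit on particles of `η`. -/
def inclusion (η x : Config L) : ℝ := ∏ j, (1 - occ x j + occ x j * occ η j)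

theorem inclusion_eq (hL : 2 ≤ L) (k : Fin L) : ∀ η x : Config L,
    inclusion η x = (∏ j ∈ (Finset.univ.erase k).erase (next k), (1 - occ x j + occ x j * occ η j))
      * ((1 - occ x k + occ x k * occ η k)
        * (1 - occ x (next k) + occ x (next k) * occ η (next k))) := by
  intro η x
  have h1 : next k ∈ Finset.univ.erase k := by simp [next_ne hL k]
  rw [inclusion, ← Finset.mul_prod_erase _ _ (Finset.mem_univ k), ← Finset.mul_prod_erase _ _ h1]
  ring

theorem occ_exchange_of_ne {k l : Fin L} (h1 : l ≠ k) (h2 : l ≠ next k) (η : Config L) :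
    occ (exchange k η) l = occ η l := by
  simp [occ_exchange, h1, h2]

theorem shockMeasure_eq {q z : ℝ} (hq : 0 < q) (η x : Config L) :
    shockMeasure L q z x η
      = z ^ particleNumber η * z⁻¹ ^ particleNumber x * (q ^ interaction η x * inclusion η x) := by
  have hx : particleNumber x = ∑ j : Fin L with x j = 1, 1 := by
    rw [particleNumber, Finset.sum_filter]
    refine Finset.sum_congr rfl fun j _ => ?_
    rcases apply_eq_zero_or_one x j with h | h <;> simp [h]
  have hz : z⁻¹ ^ particleNumber x = ∏ j : Fin L with x j = 1, z⁻¹ := by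
    rw [hx]; simp
  have hexp : q ^ interaction η x = ∏ j : Fin L with x j = 1,
      q ^ (2 / (L : ℝ) * ∑ l : Fin L, (site j - site l) * occ η l
          - ∑ i : Fin L with i < j, occ η i + ∑ i : Fin L with j < i, occ η i) := by
    rw [← Real.rpow_sum_of_pos hq, interaction, Finset.sum_filter]
    congr 1
    refine Finset.sum_congr rfl fun j _ => ?_
    rw [Finset.sum_filter, Finset.sum_filter, Finset.mul_sum, ← Finset.sum_sub_distrib,
      ← Finset.sum_add_distrib]
    rcases apply_eq_zero_or_one x j with h | h
    · simp [h, occ]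
    · rw [if_pos h]
      refine Finset.sum_congr rfl fun l _ => ?_
      have : occ x j = 1 := by simp [occ, h]
      rw [this, sawtooth]
      split_ifs <;> ring
  have hinc : inclusion η x = ∏ j : Fin L with x j = 1, occ η j := by
    rw [inclusion, Finset.prod_filter]
    refine Finset.prod_congr rfl fun j _ => ?_
    rcases apply_eq_zero_or_one x j with h | h <;> simp [h, occ]
  rw [shockMeasure, Finset.prod_mul_distrib, Finset.prod_mul_distrib, hz, hexp, hinc]
  ring

theorem bondParam_one (α : ℝ) (k : Fin L) : bondParam α 1 k = α := by
  simp [bondParam]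

/-- Duality of the actions of one bond on the two arguments of the duality function
`q ^ interaction η x * inclusion η x`, up to a term that telescopes along the ring. -/
theorem bond_duality (hL : 2 ≤ L) {q : ℝ} (w : ℝ) (hq : 0 < q) (k : Fin L) (η x : Config L) :
    (bondRate w q k η * (q ^ interaction η x * inclusion η x)
      - bondRate w (q ^ (1 - 2 * (particleNumber x : ℝ) / L)) k (exchange k η)
        * (q ^ interaction (exchange k η) x * inclusion (exchange k η) x))
    - (bondRate w q k x * (q ^ interaction η x * inclusion η x)
      - bondRate w (q ^ (1 - 2 * (particleNumber η : ℝ) / L)) k x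
        * (q ^ interaction η (exchange k x) * inclusion η (exchange k x)))
    = w * (q - q⁻¹) * (q ^ interaction η x * inclusion η x)
      * ((occ η k - occ η (next k)) - (occ x k - occ x (next k))) := by
  have hR1 : ∏ j ∈ (Finset.univ.erase k).erase (next k),
        (1 - occ x j + occ x j * occ (exchange k η) j)
      = ∏ j ∈ (Finset.univ.erase k).erase (next k), (1 - occ x j + occ x j * occ η j) := by
    refine Finset.prod_congr rfl fun j hj => ?_
    simp only [Finset.mem_erase] at hj
    rw [occ_exchange_of_ne hj.2.1 hj.1]
  have hR2 : ∏ j ∈ (Finset.univ.erase k).erase (next k),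
        (1 - occ (exchange k x) j + occ (exchange k x) j * occ η j)
      = ∏ j ∈ (Finset.univ.erase k).erase (next k), (1 - occ x j + occ x j * occ η j) := by
    refine Finset.prod_congr rfl fun j hj => ?_
    simp only [Finset.mem_erase] at hj
    rw [occ_exchange_of_ne hj.2.1 hj.1]
  rw [inclusion_eq hL k η x, inclusion_eq hL k (exchange k η) x, inclusion_eq hL k η (exchange k x),
    hR1, hR2, interaction_exchange_left hL, interaction_exchange_right hL]
  simp only [bondRate, occ_exchange_left, occ_exchange_right]
  generalize ∏ j ∈ (Finset.univ.erase k).erase (next k), (1 - occ x j + occ x j * occ η j) = R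
  generalize 2 * (particleNumber x : ℝ) / L = m
  generalize 2 * (particleNumber η : ℝ) / L = n
  generalize interaction η x = S
  have hm : q ^ m ≠ 0 := (Real.rpow_pos_of_pos hq m).ne'
  have hn : q ^ n ≠ 0 := (Real.rpow_pos_of_pos hq n).ne'
  -- The rest `R` of the product, the exponent `S` and both densities are now free parameters, so
  -- sixteen local cases remain.
  rcases occ_eq_zero_or_one η k with h1 | h1 <;> rcases occ_eq_zero_or_one η (next k) with h2 | h2 <;>
  rcases occ_eq_zero_or_one x k with h3 | h3 <;> rcases occ_eq_zero_or_one x (next k) with h4 | h4 <;>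
  simp [h1, h2, h3, h4, Real.rpow_sub hq, Real.rpow_add hq, Real.rpow_neg hq.le] <;>
  field_simp <;> ring

/-- The generators of the two globally conditioned processes are dual with respect to
`q ^ interaction η x * inclusion η x`. -/
theorem sum_bond_duality (hL : 2 ≤ L) {q : ℝ} (w : ℝ) (hq : 0 < q) (η x : Config L) :
    ∑ k, (bondRate w q k η * (q ^ interaction η x * inclusion η x)
      - bondRate w (q ^ (1 - 2 * (particleNumber x : ℝ) / L)) k (exchange k η)
        * (q ^ interaction (exchange k η) x * inclusion (exchange k η) x))
    = ∑ k, (bondRate w q k x * (q ^ interaction η x * inclusion η x)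
      - bondRate w (q ^ (1 - 2 * (particleNumber η : ℝ) / L)) k x
        * (q ^ interaction η (exchange k x) * inclusion η (exchange k x))) := by
  rw [← sub_eq_zero, ← Finset.sum_sub_distrib]
  simp only [bond_duality hL w hq]
  rw [← Finset.mul_sum, Finset.sum_sub_distrib, sum_occ_sub_occ_next, sum_occ_sub_occ_next]
  simp

end Duality

/-! ### Intertwining of the generators and semigroups -/

section Generator

variable {L : ℕ}

/-- As `exchange k` is an involution, the state feeding `η` through bond `k` is `exchange k η`; the
gain rate is evaluated there, unlike in the transposed action. -/
theorem weightedGenerator_mulVec (w q α : ℝ) (f : Config L → ℝ) (η : Config L) :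
    (weightedGenerator L w q α 1 *ᵥ f) η
      = ∑ k, (bondRate w q k η * f η - bondRate w α k (exchange k η) * f (exchange k η)) := by
  simp only [Matrix.mulVec, dotProduct, weightedGenerator, Matrix.of_apply, Finset.sum_mul]
  rw [Finset.sum_comm]
  refine Finset.sum_congr rfl fun k _ => ?_
  simp only [sub_mul, Finset.sum_sub_distrib, bondParam_one, eq_exchange_comm (ζ := η)]
  simp

theorem vecMul_weightedGenerator (w q α : ℝ) (f : Config L → ℝ) (x : Config L) :
    (f ᵥ* weightedGenerator L w q α 1) x
      = ∑ k, (bondRate w q k x * f x - bondRate w α k x * f (exchange k x)) := by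
  simp only [Matrix.vecMul, dotProduct, weightedGenerator, Matrix.of_apply, Finset.mul_sum]
  rw [Finset.sum_comm]
  refine Finset.sum_congr rfl fun k _ => ?_
  simp only [mul_sub, Finset.sum_sub_distrib, bondParam_one]
  simp [mul_comm]

theorem projector_mul_projector (N : ℕ) : projector L N * projector L N = projector L N := by
  simp [projector, Matrix.diagonal_mul_diagonal]

theorem projector_mulVec_apply (N : ℕ) (f : Config L → ℝ) (η : Config L) :
    (projector L N *ᵥ f) η = if particleNumber η = N then f η else 0 := by
  simp [projector, Matrix.mulVec_diagonal]

theorem projector_mul_apply (N : ℕ) (M : Matrix (Config L) (Config L) ℝ) (η x : Config L) :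
    (projector L N * M) η x = if particleNumber η = N then M η x else 0 := by
  simp [projector, Matrix.diagonal_mul]

theorem mul_projector_apply (N : ℕ) (M : Matrix (Config L) (Config L) ℝ) (η x : Config L) :
    (M * projector L N) η x = if particleNumber x = N then M η x else 0 := by
  simp [projector, Matrix.mul_diagonal]

/-- The matrix with the columns `|μ_x^N⟩` for `x` with `K` particles, the other columns being `0`. -/
def shockMatrix (L : ℕ) (q z : ℝ) (N K : ℕ) : Matrix (Config L) (Config L) ℝ :=
  projector L N * Matrix.of (fun η x => shockMeasure L q z x η) * projector L K

theorem shockMatrix_apply (q z : ℝ) (N K : ℕ) (η x : Config L) :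
    shockMatrix L q z N K η x = if particleNumber x = K then shockMeasureN L q z N x η else 0 := by
  rw [shockMatrix, mul_projector_apply, projector_mul_apply, shockMeasureN, projector_mulVec_apply,
    Matrix.of_apply]

theorem projector_mul_shockMatrix (q z : ℝ) (N K : ℕ) :
    projector L N * shockMatrix L q z N K = shockMatrix L q z N K := by
  rw [shockMatrix, ← mul_assoc, ← mul_assoc, projector_mul_projector]

theorem shockMatrix_mul_projector (q z : ℝ) (N K : ℕ) :
    shockMatrix L q z N K * projector L K = shockMatrix L q z N K := by
  rw [shockMatrix, mul_assoc, projector_mul_projector]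

theorem shockMatrix_eq {q z : ℝ} (hq : 0 < q) (N K : ℕ) (η x : Config L) :
    shockMatrix L q z N K η x = if particleNumber x = K then if particleNumber η = N then
      z ^ N * z⁻¹ ^ K * (q ^ interaction η x * inclusion η x) else 0 else 0 := by
  rw [shockMatrix_apply, shockMeasureN, projector_mulVec_apply, shockMeasure_eq hq]
  split_ifs with h1 h2 <;> simp [*]

/-- The shock measures intertwine the two globally conditioned generators. -/
theorem semiconjBy_globalGenerator (hL : 2 ≤ L) {q : ℝ} (w z : ℝ) (hq : 0 < q) (N K : ℕ) :
    SemiconjBy (shockMatrix L q z N K) (globalGenerator L w q K N) (globalGenerator L w q N K) := by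
  unfold SemiconjBy globalGenerator
  rw [← mul_assoc, ← mul_assoc, shockMatrix_mul_projector, mul_assoc (projector L N * _),
    projector_mul_shockMatrix, mul_assoc (projector L N)]
  ext η x
  rw [mul_projector_apply, projector_mul_apply]
  have h1 := vecMul_weightedGenerator w q (q ^ (1 - 2 * (N : ℝ) / L))
    (shockMatrix L q z N K η) x
  have h2 := weightedGenerator_mulVec w q (q ^ (1 - 2 * (K : ℝ) / L))
    (fun ζ => shockMatrix L q z N K ζ x) η
  have h1' : (shockMatrix L q z N K * weightedGenerator L w q (q ^ (1 - 2 * (N : ℝ) / L)) 1) η x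
    = _ := h1
  have h2' : (weightedGenerator L w q (q ^ (1 - 2 * (K : ℝ) / L)) 1 * shockMatrix L q z N K) η x
    = _ := h2
  rw [h1', h2']
  simp only [shockMatrix_eq hq, particleNumber_exchange]
  by_cases hx : particleNumber x = K
  · by_cases hη : particleNumber η = N
    · have h := congrArg (fun r => z ^ N * z⁻¹ ^ K * r) (sum_bond_duality hL w hq η x)
      simp only [Finset.mul_sum, hx, hη] at h
      simp only [hx, hη, if_true]
      refine Eq.trans (Finset.sum_congr rfl fun k _ => ?_)
        (h.symm.trans (Finset.sum_congr rfl fun k _ => ?_)) <;> ring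
    · simp [hη]
  · simp [hx]

theorem semiconjBy_exp_globalGenerator (hL : 2 ≤ L) {q : ℝ} (w z : ℝ) (hq : 0 < q) (N K : ℕ)
    (t : ℝ) :
    SemiconjBy (shockMatrix L q z N K) (NormedSpace.exp (-(t • globalGenerator L w q K N)))
      (NormedSpace.exp (-(t • globalGenerator L w q N K))) := by
  -- A submultiplicative norm, needed only for the lemma on exponentials.
  let : NormedRing (Matrix (Config L) (Config L) ℝ) := Matrix.linftyOpNormedRing
  let : NormedAlgebra ℝ (Matrix (Config L) (Config L) ℝ) := Matrix.linftyOpNormedAlgebra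
  let : NormedAlgebra ℚ (Matrix (Config L) (Config L) ℝ) := .restrictScalars ℚ ℝ _
  have h := semiconjBy_globalGenerator hL w z hq N K
  refine SemiconjBy.exp_right (SemiconjBy.neg_right ?_)
  unfold SemiconjBy at h ⊢
  rw [mul_smul_comm, smul_mul_assoc, h]

end Generator

end ASEP

end

theorem theorem2 (L : ℕ) (hL : 2 ≤ L) (w q z : ℝ) (hw : w ≠ 0) (hq : 0 < q) (hq1 : q ≠ 1)
    (hz : 0 < z) (N K : ℕ) (x : ASEP.Config L) (hx : ASEP.particleNumber x = K) (t : ℝ) :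
    NormedSpace.exp (-(t • ASEP.globalGenerator L w q N K)) *ᵥ ASEP.shockMeasureN L q z N x
      = ∑ y : ASEP.Config L with ASEP.particleNumber y = K,
          ASEP.transitionProb L w q K N t y x • ASEP.shockMeasureN L q z N y := by
  have h := ASEP.semiconjBy_exp_globalGenerator hL w z hq N K t
  funext η
  have hcol : ASEP.shockMeasureN L q z N x = fun ζ => ASEP.shockMatrix L q z N K ζ x := by
    funext ζ
    rw [ASEP.shockMatrix_apply, if_pos hx]
  rw [hcol]
  -- Columns of `shockMatrix` outside the `K`-particle sector vanish, so the matrix product is the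
  -- filtered sum.
  refine (congrFun (congrFun h.eq η) x).symm.trans ?_
  rw [Matrix.mul_apply, Finset.sum_apply, Finset.sum_filter]
  refine Finset.sum_congr rfl fun y _ => ?_
  rw [ASEP.shockMatrix_apply]
  split_ifs
  · rw [Pi.smul_apply, smul_eq_mul, ASEP.transitionProb, mul_comm]
  · rw [zero_mul]
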